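/- A graph here has finitely many vertices and edges; an edge is a normal edge (two distinct end-vertices, adding 1 to the degree of each), a loop (one end-vertex, adding 2 to its degree) or a semi-edge (one end-vertex, adding 1 to its degree), and multiple edges of every kind are allowed. A graph is simple if it has no loops, no semi-edges and no multiple normal edges. For an edge $e$ and a vertex $v$ let $m(e,v)$ be the amount that $e$ adds to the degree of $v$ (so $m(e,v)\in\{0,1,2\}$). A semi-covering projection from $G$ to $H$ is a pair of surjective maps $f_V:V(G)\to V(H)$, $f_E:E(G)\to E(H)$ such that $f_V$ preserves degrees; the end-vertices of $f_E(e)$ are exactly the images under $f_V$ of the end-vertices of $e$, for every edge $e$ of $G$; and $f_E$ is a local bijection (of half-edges), that is, $\sum_{e\in f_E^{-1}(e')}m(e,u)=m(e',f_V(u))$ for every $u\in V(G)$ and $e'\in E(H)$. It is a covering projection if moreover $f_E$ maps semi-edges to semi-edges and loops to loops. $G$ (semi-)covers $H$ if there is a (semi-)covering projection from $G$ to $H$. $A$ is stronger than $B$, written $A\triangleright B$, if every simple graph that covers $A$ also covers $B$. $F(1,1)$ is the one-vertex graph with one semi-edge and one loop. A semi-perfect matching of $A$ is a set $M$ of edges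 forming a spanning 1-regular subgraph, i.e. $\sum_{e\in M}m(e,v)=1$ for every vertex $v$. Theorem. For every graph $A$ (connected or not), $A\triangleright F(1,1)$ if and only if $A$ semi-covers $F(1,1)$. Moreover, $A$ semi-covers $F(1,1)$ if and only if $A$ is non-empty, cubic (every vertex has degree 3) and has a semi-perfect matching. -/

import Mathlib

/-- A (finite, once `V` and `E` are) undirected graph with vertex set `V` and edge set `E` in which
loops, semi-edges, and multiple edges of every kind are allowed.  Every edge has an unordered pair
of end-vertices.  If the two end-vertices differ it is a normal edge; if they coincide it is a
semi-edge when `IsSemi` holds and a loop otherwise. -/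
structure SemiGraph (V E : Type*) where
  /-- The unordered pair of end-vertices; it is `s(v, v)` for a loop or a semi-edge at `v`. -/
  ends : E → Sym2 V
  /-- The edge is a semi-edge. -/
  IsSemi : E → Prop
  /-- A semi-edge is incident with a single vertex. -/
  isDiag_of_isSemi : ∀ e, IsSemi e → (ends e).IsDiag

namespace SemiGraph

variable {V E V' E' : Type*}

/-- The edge `e` is a loop. -/
def IsLoop (G : SemiGraph V E) (e : E) : Prop := (G.ends e).IsDiag ∧ ¬ G.IsSemi e

/-- A graph is simple if it has no semi-edges, no loops and no multiple normal edges. -/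
def IsSimple (G : SemiGraph V E) : Prop :=
  (∀ e, ¬ G.IsSemi e) ∧ (∀ e, ¬ G.IsLoop e) ∧ Function.Injective G.ends

open Classical in
/-- What the edge `e` adds to the degree of the vertex `v`, that is, the number of half-edges of `e`
at `v`: a loop at `v` counts 2, a semi-edge at `v` or a normal edge with end-vertex `v` counts 1,
and an edge not incident with `v` counts 0. -/
noncomputable def mult (G : SemiGraph V E) (e : E) (v : V) : ℕ :=
  if v ∈ G.ends e then (if G.IsLoop e then 2 else 1) else 0

/-- The degree of a vertex. -/
noncomputable def degree [Fintype E] (G : SemiGraph V E) (v : V) : ℕ := ∑ e, G.mult e v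

/-- A graph is cubic if all its vertices have degree 3. -/
def IsCubic [Fintype E] (G : SemiGraph V E) : Prop := ∀ v, G.degree v = 3

open Classical in
/-- The pair `fV, fE` is a semi-covering projection from `G` to `H`.

The local bijection between edge-neighbourhoods is one between half-edges, because a loop of `H` is
the image of a vertex-disjoint union of cycles (and, for semi-coverings, open paths), so that two
different edges at `u` may be sent to the same loop at `fV u`.  Thus for every edge `e'` of `H` the
edges of `G` sent to `e'` have together as many half-edges at `u` as `e'` has at `fV u`. -/
structure IsSemiCovering [Fintype E] [Fintype E'] (G : SemiGraph V E) (H : SemiGraph V' E')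
    (fV : V → V') (fE : E → E') : Prop where
  surjective_vert : Function.Surjective fV
  surjective_edge : Function.Surjective fE
  /-- `fV` is degree preserving. -/
  degree_eq : ∀ u, H.degree (fV u) = G.degree u
  /-- `fE` is incidence preserving: the end-vertices of `fE e` are the images of those of `e`. -/
  ends_eq : ∀ e, H.ends (fE e) = (G.ends e).map fV
  /-- `fE` is a local bijection at every vertex. -/
  local_bij : ∀ (u : V) (e' : E'), ∑ e with fE e = e', G.mult e u = H.mult e' (fV u)

/-- The pair `fV, fE` is a covering projection from `G` to `H`: a semi-covering projection that
maps semi-edges to semi-edges and loops to loops. -/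
structure IsCovering [Fintype E] [Fintype E'] (G : SemiGraph V E) (H : SemiGraph V' E')
    (fV : V → V') (fE : E → E') : Prop extends IsSemiCovering G H fV fE where
  isSemi_map : ∀ e, G.IsSemi e → H.IsSemi (fE e)
  isLoop_map : ∀ e, G.IsLoop e → H.IsLoop (fE e)

/-- `G` semi-covers `H`. -/
def SemiCovers [Fintype E] [Fintype E'] (G : SemiGraph V E) (H : SemiGraph V' E') : Prop :=
  ∃ (fV : V → V') (fE : E → E'), IsSemiCovering G H fV fE

/-- `G` covers `H`. -/
def Covers [Fintype E] [Fintype E'] (G : SemiGraph V E) (H : SemiGraph V' E') : Prop :=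
  ∃ (fV : V → V') (fE : E → E'), IsCovering G H fV fE

/-- `A` is stronger than `B`: every finite simple graph that covers `A` also covers `B`.
(As `G` is finite, nothing is lost by letting its vertices and edges form types in `Type`.) -/
def Stronger [Fintype E] [Fintype E'] (A : SemiGraph V E) (B : SemiGraph V' E') : Prop :=
  ∀ (W F : Type) [Fintype W] [Fintype F] (G : SemiGraph W F),
    G.IsSimple → G.Covers A → G.Covers B

/-- The one-vertex graph with `a` semi-edges and `b` loops. -/
def flower (a b : ℕ) : SemiGraph Unit (Fin a ⊕ Fin b) where
  ends _ := s((), ())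
  IsSemi e := e.isLeft
  isDiag_of_isSemi _ _ := rfl

/-- `M` is a semi-perfect matching of `G`: the edges of `M` form a spanning 1-regular subgraph. -/
def IsSemiPerfectMatching (G : SemiGraph V E) (M : Finset E) : Prop :=
  ∀ v, ∑ e ∈ M, G.mult e v = 1

end SemiGraph

/-!
The flower `F(1,1)` has one vertex, so a semi-covering `A → F(1,1)` is just a 2-colouring of the
edges of a non-empty cubic graph in which the preimage of the semi-edge is a semi-perfect matching
(`semiCovers_flower_iff`).  Semi-coverings compose, and on a simple graph every semi-covering of
`F(1,1)` is a covering, because there is no semi-edge or loop to be preserved; hence a graph that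
semi-covers `F(1,1)` is stronger than `F(1,1)`.

For the converse it is enough to find one simple graph `G` that covers `A` and whose perfect
matchings induce semi-perfect matchings of `A`.  Let `G₀` be a simple cover of `A` of even order.
Take two copies of `A` (the two layers; a semi-edge of `A` joins its two lifts), and for every
edge `e` of each layer a fresh copy of `G₀`, the *piece* of `e`.  Cut `e`, cut an edge over `e` in
its piece, and reconnect the four half-edges crosswise.  (An edge that joins the two layers counts
for the first one; the copy of `G₀` it has in the second stays apart.)  The result is a simple cover
of `A`.
A piece has an even number of vertices and only two edges leave it, so a perfect matching of `G`
uses both of them or neither (`mem_iff_mem_of_perfect`).  The edges `e` of the first layer for which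
both are used therefore form a semi-perfect matching of `A`
(`exists_isSemiPerfectMatching_of_switched`).

The graph `G` is encoded as a lift of `A` by permutations: its vertices are pairs of a vertex of `A`
and a sheet, and an edge `e` of `A` is lifted along a permutation of the sheets (`derived`).
The piece sheets are indexed by functions `E → ZMod 3`, and `e` translates by the indicator of `e`;
these translations are nonzero, distinct, and not inverse to one another, which is what makes the
lift simple (`isSimple_switched`).
-/

namespace SemiGraph

/-! ### Half-edge counts -/

section Basic

variable {V E V' E' V'' E'' : Type*}

lemma mult_of_not_isSemi [DecidableEq V] (G : SemiGraph V E) {e : E} {a b : V} (he : G.ends e = s(a, b))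
    (h : ¬ G.IsSemi e) (v : V) :
    G.mult e v = (if a = v then 1 else 0) + (if b = v then 1 else 0) := by
  unfold mult IsLoop
  rw [he]
  simp only [Sym2.mem_iff, Sym2.mk_isDiag_iff, h, not_false_eq_true, and_true]
  by_cases hab : a = b
  · subst hab
    by_cases hv : v = a
    · simp [hv]
    · simp [hv, Ne.symm hv]
  · by_cases hv : v = a
    · subst hv; simp [hab, Ne.symm hab]
    · by_cases hv' : v = b
      · subst hv'; simp [hab]
      · simp [hv, hv', Ne.symm hv, Ne.symm hv']

lemma mult_of_isSemi [DecidableEq V] (G : SemiGraph V E) {e : E} {a b : V} (he : G.ends e = s(a, b))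
    (h : G.IsSemi e) (v : V) :
    G.mult e v = if a = v then 1 else 0 := by
  have hab : a = b := by
    have := G.isDiag_of_isSemi e h
    rwa [he, Sym2.mk_isDiag_iff] at this
  subst hab
  unfold mult IsLoop
  rw [he]
  simp [h, eq_comm]

open Classical in
lemma degree_eq_of_local_bij [Fintype E] [Fintype E'] {G : SemiGraph V E} {H : SemiGraph V' E'}
    {fV : V → V'} {fE : E → E'}
    (h : ∀ (u : V) (e' : E'), ∑ e with fE e = e', G.mult e u = H.mult e' (fV u)) (u : V) :
    H.degree (fV u) = G.degree u := by
  unfold degree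
  rw [← Finset.sum_fiberwise Finset.univ fE]
  exact Finset.sum_congr rfl fun e' _ => (h u e').symm

/-! ### Composition of coverings and independence of the universe -/

lemma IsSemiCovering.comp [Fintype E] [Fintype E'] [Fintype E''] {G : SemiGraph V E}
    {H : SemiGraph V' E'} {K : SemiGraph V'' E''} {fV : V → V'} {fE : E → E'} {gV : V' → V''}
    {gE : E' → E''} (hg : IsSemiCovering H K gV gE) (hf : IsSemiCovering G H fV fE) :
    IsSemiCovering G K (gV ∘ fV) (gE ∘ fE) where
  surjective_vert := hg.surjective_vert.comp hf.surjective_vert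
  surjective_edge := hg.surjective_edge.comp hf.surjective_edge
  degree_eq u := (hg.degree_eq _).trans (hf.degree_eq u)
  ends_eq e := by
    rw [Function.comp_apply, hg.ends_eq, hf.ends_eq, Sym2.map_map]
  local_bij u e'' := by
    classical
    rw [Function.comp_apply, ← hg.local_bij (fV u) e'', Finset.sum_filter, Finset.sum_filter,
      ← Finset.sum_fiberwise Finset.univ fE]
    refine Finset.sum_congr rfl fun e' _ => ?_
    by_cases h : gE e' = e''
    · rw [if_pos h, ← hf.local_bij u e']
      refine Finset.sum_congr (by ext; simp) fun e he => ?_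
      rw [Finset.mem_filter] at he
      simp [he.2, h]
    · rw [if_neg h]
      refine Finset.sum_eq_zero fun e he => ?_
      rw [Finset.mem_filter] at he
      simp [he.2, h]

lemma Covers.trans [Fintype E] [Fintype E'] [Fintype E''] {G : SemiGraph V E}
    {H : SemiGraph V' E'} {K : SemiGraph V'' E''} (h₁ : G.Covers H) (h₂ : H.Covers K) :
    G.Covers K := by
  obtain ⟨fV, fE, hf⟩ := h₁
  obtain ⟨gV, gE, hg⟩ := h₂
  exact ⟨_, _, hg.toIsSemiCovering.comp hf.toIsSemiCovering,
    fun e he => hg.isSemi_map _ (hf.isSemi_map e he),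
    fun e he => hg.isLoop_map _ (hf.isLoop_map e he)⟩

/-- The graph `G` with its vertices and edges renamed. -/
def relabel (G : SemiGraph V E) (eV : V ≃ V') (eE : E ≃ E') : SemiGraph V' E' where
  ends e := (G.ends (eE.symm e)).map eV
  IsSemi e := G.IsSemi (eE.symm e)
  isDiag_of_isSemi e he := by
    have := G.isDiag_of_isSemi _ he
    revert this
    induction G.ends (eE.symm e) with
    | _ a b => simp

lemma isDiag_relabel_ends (G : SemiGraph V E) (eV : V ≃ V') (eE : E ≃ E') (e : E') :
    ((G.relabel eV eE).ends e).IsDiag ↔ (G.ends (eE.symm e)).IsDiag := by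
  change ((G.ends (eE.symm e)).map eV).IsDiag ↔ _
  induction G.ends (eE.symm e) with
  | _ a b => simp

lemma isLoop_relabel (G : SemiGraph V E) (eV : V ≃ V') (eE : E ≃ E') (e : E') :
    (G.relabel eV eE).IsLoop e ↔ G.IsLoop (eE.symm e) :=
  and_congr (isDiag_relabel_ends G eV eE e) Iff.rfl

lemma mult_relabel (G : SemiGraph V E) (eV : V ≃ V') (eE : E ≃ E') (e : E) (v : V) :
    (G.relabel eV eE).mult (eE e) (eV v) = G.mult e v := by
  have hmem : eV v ∈ (G.relabel eV eE).ends (eE e) ↔ v ∈ G.ends e := by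
    change eV v ∈ (G.ends (eE.symm (eE e))).map eV ↔ _
    rw [Equiv.symm_apply_apply]
    simp
  have hloop : (G.relabel eV eE).IsLoop (eE e) ↔ G.IsLoop e := by
    rw [isLoop_relabel, Equiv.symm_apply_apply]
  unfold mult
  by_cases hv : v ∈ G.ends e <;> by_cases hl : G.IsLoop e <;>
    simp only [hmem, hloop, hv, hl, if_true, if_false]

lemma IsSimple.relabel {G : SemiGraph V E} (h : G.IsSimple) (eV : V ≃ V') (eE : E ≃ E') :
    (G.relabel eV eE).IsSimple :=
  ⟨fun _ => h.1 _, fun e he => h.2.1 _ ((isLoop_relabel G eV eE e).1 he),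
    (Sym2.map.injective eV.injective).comp (h.2.2.comp eE.symm.injective)⟩

lemma covers_relabel [Fintype E] [Fintype E'] (G : SemiGraph V E) (eV : V ≃ V') (eE : E ≃ E') :
    G.Covers (G.relabel eV eE) := by
  classical
  have hl : ∀ (u : V) (e' : E'),
      ∑ e with eE e = e', G.mult e u = (G.relabel eV eE).mult e' (eV u) := by
    intro u e'
    obtain ⟨e, rfl⟩ := eE.surjective e'
    rw [mult_relabel]
    simp [Finset.sum_filter]
  refine ⟨eV, eE, ⟨eV.surjective, eE.surjective, degree_eq_of_local_bij (by convert hl), fun e => ?_,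
    by convert hl⟩, fun e he => ?_, fun e he => ?_⟩
  · change (G.ends (eE.symm (eE e))).map eV = _
    rw [Equiv.symm_apply_apply]
  · change G.IsSemi (eE.symm (eE e))
    rwa [Equiv.symm_apply_apply]
  · rw [isLoop_relabel]; simpa using he

lemma relabel_covers [Fintype E] [Fintype E'] (G : SemiGraph V E) (eV : V ≃ V') (eE : E ≃ E') :
    (G.relabel eV eE).Covers G := by
  have h := covers_relabel (G.relabel eV eE) eV.symm eE.symm
  have : (G.relabel eV eE).relabel eV.symm eE.symm = G := by
    cases G
    simp [SemiGraph.relabel, Sym2.map_map]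
  rwa [this] at h

/-- `Stronger` only speaks of graphs in `Type`; by relabelling it applies in every universe. -/
lemma Stronger.covers [Fintype E] [Fintype E'] {A : SemiGraph V E} {B : SemiGraph V' E'}
    (h : A.Stronger B) {W F : Type*} [Fintype W] [Fintype F] {G : SemiGraph W F}
    (hs : G.IsSimple) (hc : G.Covers A) : G.Covers B :=
  (covers_relabel G (Fintype.equivFin W) (Fintype.equivFin F)).trans <|
    h _ _ _ (hs.relabel _ _) ((relabel_covers G _ _).trans hc)

/-! ### Semi-coverings of the flower -/

lemma flower_mult_inl (v : Unit) (i : Fin 1) : (flower 1 1).mult (Sum.inl i) v = 1 := by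
  rw [mult_of_isSemi (a := ()) (b := ()) _ rfl (by simp [flower])]
  simp

lemma flower_mult_inr (v : Unit) (i : Fin 1) : (flower 1 1).mult (Sum.inr i) v = 2 := by
  rw [mult_of_not_isSemi (a := ()) (b := ()) _ rfl (by simp [flower])]
  simp

lemma flower_degree (v : Unit) : (flower 1 1).degree v = 3 := by
  simp [degree, flower_mult_inl, flower_mult_inr]

theorem semiCovers_flower_iff [Fintype E] (A : SemiGraph V E) :
    A.SemiCovers (flower 1 1) ↔
      Nonempty V ∧ A.IsCubic ∧ ∃ M : Finset E, A.IsSemiPerfectMatching M := by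
  classical
  constructor
  · rintro ⟨fV, fE, h⟩
    obtain ⟨v, -⟩ := h.surjective_vert ()
    refine ⟨⟨v⟩, fun u => ?_, Finset.univ.filter (fun e => fE e = Sum.inl 0), fun u => ?_⟩
    · rw [← h.degree_eq, flower_degree]
    · have := h.local_bij u (Sum.inl 0)
      rw [flower_mult_inl] at this
      convert this
  · rintro ⟨⟨v⟩, hc, M, hM⟩
    let fE : E → Fin 1 ⊕ Fin 1 := fun e => if e ∈ M then Sum.inl 0 else Sum.inr 0
    have hinl : ∀ u, ∑ e with fE e = Sum.inl 0, A.mult e u = 1 := by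
      intro u
      refine Eq.trans ?_ (hM u)
      refine Finset.sum_congr ?_ fun _ _ => rfl
      ext e
      by_cases he : e ∈ M <;> simp [fE, he]
    have hinr : ∀ u, ∑ e with fE e = Sum.inr 0, A.mult e u = 2 := by
      intro u
      have h1 : ∑ e with fE e = Sum.inr 0, A.mult e u = ∑ e with ¬ fE e = Sum.inl 0, A.mult e u := by
        refine Finset.sum_congr ?_ fun _ _ => rfl
        ext e
        by_cases he : e ∈ M <;> simp [fE, he]
      have h2 := Finset.sum_filter_add_sum_filter_not Finset.univ (fun e => fE e = Sum.inl 0)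
        (fun e => A.mult e u)
      have h3 : ∑ e, A.mult e u = 3 := hc u
      rw [hinl] at h2
      omega
    refine ⟨fun _ => (), fE, fun _ => ⟨v, rfl⟩, ?_, fun u => ?_, fun e => ?_, ?_⟩
    -- A colour that does not occur would have half-edge sum `0` at `v`.
    · rintro (i | i)
      · obtain rfl : i = 0 := Subsingleton.elim _ _
        by_contra hne
        push Not at hne
        simpa [hne] using hinl v
      · obtain rfl : i = 0 := Subsingleton.elim _ _
        by_contra hne
        push Not at hne
        simpa [hne] using hinr v
    · rw [flower_degree, hc u]
    · induction A.ends e with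
      | _ a b => rfl
    · rintro u (i | i)
      · obtain rfl : i = 0 := Subsingleton.elim _ _
        rw [flower_mult_inl]
        convert hinl u
      · obtain rfl : i = 0 := Subsingleton.elim _ _
        rw [flower_mult_inr]
        convert hinr u

lemma stronger_of_semiCovers [Fintype E] [Fintype E'] {A : SemiGraph V E} {B : SemiGraph V' E'}
    (h : A.SemiCovers B) : A.Stronger B := by
  obtain ⟨gV, gE, hg⟩ := h
  rintro W F _ _ G hs ⟨fV, fE, hf⟩
  exact ⟨_, _, hg.comp hf.toIsSemiCovering, fun e he => (hs.1 e he).elim,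
    fun e he => (hs.2.1 e he).elim⟩

end Basic

/-! ### Lifts along permutations -/

section Derived

variable {V E K : Type*}

/-- The tail of the edge `e` in an arbitrarily chosen orientation. -/
noncomputable def src (A : SemiGraph V E) (e : E) : V := (Quot.out (A.ends e)).1

/-- The head of the edge `e` in an arbitrarily chosen orientation. -/
noncomputable def tgt (A : SemiGraph V E) (e : E) : V := (Quot.out (A.ends e)).2

lemma ends_eq_src_tgt (A : SemiGraph V E) (e : E) : A.ends e = s(A.src e, A.tgt e) :=
  (Quot.out_eq (A.ends e)).symm

lemma src_eq_tgt_of_isSemi (A : SemiGraph V E) {e : E} (h : A.IsSemi e) : A.src e = A.tgt e := by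
  have := A.isDiag_of_isSemi e h
  rwa [ends_eq_src_tgt, Sym2.mk_isDiag_iff] at this

/-- The tail of the lift of `x.1` that starts in the sheet `x.2`. -/
noncomputable def liftSrc (A : SemiGraph V E) (x : E × K × Bool) : V × K × Bool :=
  (A.src x.1, x.2.1, x.2.2)

open Classical in
/-- The head of the lift of `x.1` that starts in the sheet `x.2`.  A loop or normal edge stays in
its layer, a semi-edge passes from the layer `false` to the layer `true`. -/
noncomputable def liftTgt (A : SemiGraph V E) (π : E → Bool → Equiv.Perm K) (x : E × K × Bool) :
    V × K × Bool :=
  (A.tgt x.1, π x.1 x.2.2 x.2.1, x.2.2 || decide (A.IsSemi x.1))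

/-- The lift of `A` along permutations `π`: the sheets are `K × Bool`, the second component being
the layer, and the lifts of an edge `e` that start in layer `i` follow the permutation `π e i`.
The lifts of a semi-edge are normal edges between the two layers, and are indexed by their end in
the layer `false`. -/
noncomputable def derived (A : SemiGraph V E) (π : E → Bool → Equiv.Perm K) :
    SemiGraph (V × K × Bool) {x : E × K × Bool // A.IsSemi x.1 → x.2.2 = false} where
  ends x := s(A.liftSrc x.1, A.liftTgt π x.1)
  IsSemi _ := False
  isDiag_of_isSemi _ h := h.elim

lemma derived_mult [DecidableEq (V × K × Bool)] (A : SemiGraph V E) (π : E → Bool → Equiv.Perm K)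
    (x : {x : E × K × Bool // A.IsSemi x.1 → x.2.2 = false}) (w : V × K × Bool) :
    (A.derived π).mult x w =
      (if A.liftSrc x.1 = w then 1 else 0) + (if A.liftTgt π x.1 = w then 1 else 0) :=
  mult_of_not_isSemi _ rfl id w

open Classical in
lemma derived_local_bij [Fintype K] (A : SemiGraph V E)
    [Fintype {x : E × K × Bool // A.IsSemi x.1 → x.2.2 = false}] (π : E → Bool → Equiv.Perm K) (u : V × K × Bool) (e : E) :
    ∑ x with x.1.1 = e, (A.derived π).mult x u = A.mult e u.1 := by
  obtain ⟨v, k, i⟩ := u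
  simp only [derived_mult]
  have key : ∀ φ : E × K × Bool → ℕ,
      ∑ x : {x : E × K × Bool // A.IsSemi x.1 → x.2.2 = false} with x.1.1 = e, φ x.1 =
        ∑ k : K, ∑ j : Bool, if A.IsSemi e → j = false then φ (e, k, j) else 0 := by
    intro φ
    rw [← Fintype.sum_prod_type', ← Finset.sum_filter]
    refine Finset.sum_bij (fun x _ => x.1.2) ?_ ?_ ?_ ?_
    · rintro ⟨⟨e', k', j⟩, h⟩ hx
      simp only [Finset.mem_filter, Finset.mem_univ, true_and] at hx ⊢
      subst hx
      exact h
    · rintro ⟨⟨e', k', j⟩, h⟩ hx ⟨⟨e'', k'', j'⟩, h'⟩ hx' heq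
      simp only [Finset.mem_filter, Finset.mem_univ, true_and] at hx hx' heq
      subst hx
      subst hx'
      simp [heq]
    · rintro ⟨k', j⟩ h
      simp only [Finset.mem_filter, Finset.mem_univ, true_and] at h
      exact ⟨⟨(e, k', j), h⟩, by simp, rfl⟩
    · rintro ⟨⟨e', k', j⟩, h⟩ hx
      simp only [Finset.mem_filter, Finset.mem_univ, true_and] at hx
      subst hx
      rfl
  rw [key fun x => (if A.liftSrc x = (v, k, i) then 1 else 0) +
    (if A.liftTgt π x = (v, k, i) then 1 else 0)]
  have hperm : ∀ j k', π e j k' = k ↔ k' = (π e j).symm k := fun j k' =>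
    (Equiv.eq_symm_apply _).symm
  by_cases hs : A.IsSemi e
  · rw [mult_of_isSemi A (ends_eq_src_tgt A e) hs]
    by_cases hv : A.src e = v
    · have hv' : A.tgt e = v := (src_eq_tgt_of_isSemi A hs).symm.trans hv
      cases i <;> simp [liftSrc, liftTgt, hs, hv, hv', hperm]
    · have hv' : ¬ A.tgt e = v := fun h => hv ((src_eq_tgt_of_isSemi A hs).trans h)
      simp [liftSrc, liftTgt, hv, hv']
  · rw [mult_of_not_isSemi A (ends_eq_src_tgt A e) hs]
    by_cases hv : A.src e = v <;> by_cases hv' : A.tgt e = v <;> cases i <;>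
      simp [liftSrc, liftTgt, hs, hv, hv', hperm, Finset.sum_add_distrib, -Finset.sum_boole]

lemma derived_covers [Fintype E] [Fintype K] [Nonempty K] (A : SemiGraph V E)
    [Fintype {x : E × K × Bool // A.IsSemi x.1 → x.2.2 = false}] (π : E → Bool → Equiv.Perm K) (hs : (A.derived π).IsSimple) :
    (A.derived π).Covers A := by
  have k : K := Classical.arbitrary K
  refine ⟨Prod.fst, fun x => x.1.1, ⟨fun v => ⟨(v, k, false), rfl⟩,
    fun e => ⟨⟨(e, k, false), fun _ => rfl⟩, rfl⟩,
    degree_eq_of_local_bij (derived_local_bij A π), fun x => ends_eq_src_tgt A x.1.1,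
    derived_local_bij A π⟩, fun e he => he.elim, fun e he => (hs.2.1 e he).elim⟩

lemma isSimple_derived (A : SemiGraph V E) (π : E → Bool → Equiv.Perm K)
    (h_fix : ∀ e i k, π e i k ≠ k) (h_ne : ∀ e e' i k, π e i k = π e' i k → e = e')
    (h_inv : ∀ e e' i k, π e i (π e' i k) ≠ k) : (A.derived π).IsSimple := by
  refine ⟨fun _ => id, ?_, ?_⟩
  · rintro ⟨⟨e, k, i⟩, hx⟩ ⟨hd, -⟩
    have hd' : A.liftSrc (e, k, i) = A.liftTgt π (e, k, i) := by simpa [derived] using hd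
    simp only [liftSrc, liftTgt, Prod.mk.injEq] at hd'
    exact h_fix e i k hd'.2.1.symm
  · rintro ⟨⟨e, k, i⟩, hx⟩ ⟨⟨e', k', i'⟩, hx'⟩ heq
    have heq' : s(A.liftSrc (e, k, i), A.liftTgt π (e, k, i)) =
      s(A.liftSrc (e', k', i'), A.liftTgt π (e', k', i')) := heq
    simp only [Sym2.eq_iff, liftSrc, liftTgt, Prod.mk.injEq] at heq'
    rcases heq' with ⟨⟨-, rfl, rfl⟩, -, hk, -⟩ | ⟨⟨-, hk, hi⟩, -, hk', hi'⟩
    · obtain rfl := h_ne _ _ _ _ hk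
      rfl
    · -- The two layers agree, as a lifted semi-edge starts in the layer `false`.
      have : i = i' := by
        by_cases hs : A.IsSemi e <;> by_cases hs' : A.IsSemi e' <;> simp_all
      subst this
      subst hk
      exact (h_inv _ _ _ _ hk').elim

end Derived

/-! ### The switched lift -/

section Switched

variable {V E : Type*}

/-- The sheets within a layer: `none` is the copy of `A`, and `some (e, i, l)` is the sheet `l` of
the piece that belongs to the edge `e` of the layer `i`. -/
abbrev Sheet (E : Type*) := Option (E × Bool × (E → ZMod 3))

open Classical in
/-- Translation by the indicator function of `e` in every piece; the sheet `none` is fixed. -/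
noncomputable def shift (e : E) : Equiv.Perm (Sheet E) :=
  Equiv.optionCongr ((Equiv.refl E).prodCongr ((Equiv.refl Bool).prodCongr
    (Equiv.addRight (Pi.single e 1))))

open Classical in
/-- The permutation along which the edge `e` of the layer `i` is lifted: the translation by `e`,
with the lifts starting in the copy of `A` and in the sheet `0` of the piece of `(e, i)`
switched. -/
noncomputable def switch (e : E) (i : Bool) : Equiv.Perm (Sheet E) :=
  (Equiv.swap none (some (e, i, 0))).trans (shift e)

open Classical in
lemma switch_none (e : E) (i : Bool) : switch e i none = some (e, i, Pi.single e 1) := by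
  simp [switch, shift]

lemma switch_zero (e : E) (i : Bool) : switch e i (some (e, i, 0)) = none := by
  simp [switch, shift]

open Classical in
lemma switch_some {e : E} {i : Bool} {x : E × Bool × (E → ZMod 3)} (h : x ≠ (e, i, 0)) :
    switch e i (some x) = some (x.1, x.2.1, x.2.2 + Pi.single e 1) := by
  rw [switch, Equiv.trans_apply, Equiv.swap_apply_of_ne_of_ne (by simp) (by simpa using h)]
  rfl

lemma switch_eq_none_iff {e : E} {i : Bool} {k : Sheet E} :
    switch e i k = none ↔ k = some (e, i, 0) := by
  rw [← switch_zero e i, (switch e i).injective.eq_iff]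

lemma switch_ne_self (e : E) (i : Bool) (k : Sheet E) : switch e i k ≠ k := by
  classical
  rcases k with _ | x
  · simp [switch_none]
  · by_cases h : x = (e, i, 0)
    · simp [h, switch_zero]
    · rw [switch_some h]
      obtain ⟨e', j, l⟩ := x
      simp

lemma eq_of_switch_eq (e e' : E) (i : Bool) (k : Sheet E) (h : switch e i k = switch e' i k) :
    e = e' := by
  classical
  rcases k with _ | x
  · simp only [switch_none, Option.some.injEq, Prod.mk.injEq] at h
    exact h.1
  · by_cases hx : x = (e, i, 0)
    · rw [hx, switch_zero, eq_comm, switch_eq_none_iff] at h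
      simpa using h
    · by_cases hx' : x = (e', i, 0)
      · rw [hx', switch_zero, switch_eq_none_iff] at h
        simpa using h.symm
      · rw [switch_some hx, switch_some hx'] at h
        simp only [Option.some.injEq, Prod.mk.injEq, true_and, add_right_inj] at h
        by_contra hne
        have := congrFun h e
        simp [hne] at this

/-- Two of the translations are never inverse to one another, since `1 + 1 ≠ 0` in `ZMod 3`. -/
lemma switch_switch_ne_self (e e' : E) (i : Bool) (k : Sheet E) :
    switch e i (switch e' i k) ≠ k := by
  classical
  rcases k with _ | x
  · rw [switch_none, Ne, switch_eq_none_iff]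
    simp
  · by_cases hx : x = (e', i, 0)
    · rw [hx, switch_zero, switch_none]
      simp
    · rw [switch_some hx]
      by_cases hy : (x.1, x.2.1, x.2.2 + Pi.single e' 1) = (e, i, (0 : E → ZMod 3))
      · rw [hy, switch_zero]
        simp
      · rw [switch_some hy]
        obtain ⟨e₁, j, l⟩ := x
        simp only [ne_eq, Option.some.injEq, Prod.mk.injEq, true_and, add_assoc, add_eq_left]
        intro h
        have h1 := congrFun h e
        by_cases hne : e = e'
        · subst hne
          simp only [Pi.add_apply, Pi.single_eq_same, Pi.zero_apply] at h1
          have h2 : (1 : ZMod 3) + 1 ≠ 0 := by decide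
          exact h2 h1
        · simp [hne] at h1

lemma isSimple_switched (A : SemiGraph V E) : (A.derived switch).IsSimple :=
  isSimple_derived A switch switch_ne_self eq_of_switch_eq switch_switch_ne_self

/-- The sheet `k` lies in the piece of the edge `e` of the first layer. -/
def InPiece (e : E) (k : Sheet E) : Prop := ∃ l, k = some (e, false, l)

/-- An edge of the switched lift has an even number of ends in the piece of `e`, except for the two
edges that leave it. -/
lemma inPiece_parity [DecidableEq (E × Sheet E × Bool)] (e e' : E) [DecidablePred (InPiece e)]
    (i : Bool) (k : Sheet E) :
    (((if InPiece e k then 1 else 0) + if InPiece e (switch e' i k) then 1 else 0 : ℕ) : ZMod 2) =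
      (if (e', k, i) = (e, none, false) then 1 else 0) +
        if (e', k, i) = (e, some (e, false, 0), false) then 1 else 0 := by
  have h2 : (2 : ZMod 2) = 0 := by decide
  classical
  rcases k with _ | x
  · simp [InPiece, switch_none]
  · by_cases hx : x = (e', i, 0)
    · subst hx
      simp only [switch_zero]
      by_cases h : e' = e ∧ i = false
      · obtain ⟨rfl, rfl⟩ := h
        simp [InPiece]
      · have : ¬ InPiece e (some (e', i, 0)) := by
          rintro ⟨l, hl⟩
          simp only [Option.some.injEq, Prod.mk.injEq] at hl
          exact h ⟨hl.1, hl.2.1⟩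
        simp only [this]
        have h' : ¬ InPiece e none := by simp [InPiece]
        simp only [h', Prod.mk.injEq, if_false]
        rw [if_neg (by simp), if_neg (by tauto)]
        simp
    · rw [switch_some hx]
      have h1 : InPiece e (some (x.1, x.2.1, x.2.2 + Pi.single e' 1)) ↔ InPiece e (some x) := by
        obtain ⟨e₁, j, l⟩ := x
        simp [InPiece]
      have h3 : (e', some x, i) ≠ (e, some (e, false, 0), false) := by
        intro h
        simp only [Prod.mk.injEq, Option.some.injEq] at h
        obtain ⟨rfl, rfl, rfl⟩ := h
        exact hx rfl
      rw [if_neg h3]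
      simp only [h1]
      by_cases h : InPiece e (some x)
      · simpa [h] using h2
      · simp [h]

/-- A perfect matching of the switched lift uses both of the edges that leave the piece of `e`, or
neither of them: the piece has an even number of vertices. -/
lemma mem_iff_mem_of_perfect [Fintype V] [Fintype E] [DecidableEq (V × Sheet E × Bool)]
    (A : SemiGraph V E)
    (M : Finset (E × Sheet E × Bool))
    (hM : ∀ w, ∑ x ∈ M, ((if A.liftSrc x = w then 1 else 0) +
      (if A.liftTgt switch x = w then 1 else 0)) = 1) (e : E) :
    (e, none, false) ∈ M ↔ (e, some (e, false, 0), false) ∈ M := by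
  classical
  have : DecidableEq (E × Sheet E × Bool) := Classical.decEq _
  let P : Finset (V × Sheet E × Bool) := Finset.univ.filter fun w => InPiece e w.2.1
  have hP : P.card = Fintype.card (V × (E → ZMod 3) × Bool) := by
    rw [← Finset.card_univ]
    symm
    refine Finset.card_bij (fun y _ => (y.1, some (e, false, y.2.1), y.2.2)) ?_ ?_ ?_
    · rintro ⟨v, l, i⟩ -
      exact Finset.mem_filter.2 ⟨Finset.mem_univ _, l, rfl⟩
    · rintro ⟨v, l, i⟩ - ⟨v', l', i'⟩ - h
      simpa using h
    · rintro ⟨v, k, i⟩ h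
      simp only [P, Finset.mem_filter, Finset.mem_univ, true_and] at h
      obtain ⟨l, rfl⟩ := h
      exact ⟨(v, l, i), Finset.mem_univ _, rfl⟩
  -- Count the half-edges of `M` in the piece, once by vertices and once by edges.
  have hcount : ∑ x ∈ M, ((if InPiece e x.2.1 then 1 else 0) +
      (if InPiece e (switch x.1 x.2.2 x.2.1) then 1 else 0) : ℕ) = P.card := by
    rw [Finset.card_eq_sum_ones, ← Finset.sum_congr rfl fun w _ => hM w, Finset.sum_comm]
    refine Finset.sum_congr rfl fun x _ => ?_
    rw [Finset.sum_add_distrib, Finset.sum_ite_eq, Finset.sum_ite_eq]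
    simp [P, liftSrc, liftTgt]
  have hcast := congrArg (Nat.cast : ℕ → ZMod 2) hcount
  rw [hP, Fintype.card_prod, Fintype.card_prod, Fintype.card_bool, Nat.cast_sum,
    Finset.sum_congr rfl fun x _ => inPiece_parity e x.1 x.2.2 x.2.1,
    Finset.sum_add_distrib, Finset.sum_ite_eq', Finset.sum_ite_eq'] at hcast
  have h2 : ((2 : ℕ) : ZMod 2) = 0 := by decide
  rw [Nat.cast_mul, Nat.cast_mul, h2, mul_zero, mul_zero] at hcast
  by_cases h1 : (e, none, false) ∈ M <;>
    by_cases h3 : (e, some (e, false, 0), false) ∈ M <;> simp_all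

/-- The edges of `A` whose lifts from the first copy of `A` to their pieces are matched form a
semi-perfect matching of `A`. -/
theorem exists_isSemiPerfectMatching_of_switched [Fintype V] [Fintype E] (A : SemiGraph V E)
    (h : ∃ M, (A.derived switch).IsSemiPerfectMatching M) :
    ∃ M : Finset E, A.IsSemiPerfectMatching M := by
  obtain ⟨M₀, hM₀⟩ := h
  classical
  have : DecidableEq (V × Sheet E × Bool) := Classical.decEq _
  let M : Finset (E × Sheet E × Bool) := M₀.map (Function.Embedding.subtype _)
  have hM : ∀ w, ∑ x ∈ M, ((if A.liftSrc x = w then 1 else 0) +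
      (if A.liftTgt switch x = w then 1 else 0)) = 1 := by
    intro w
    refine Eq.trans ?_ (hM₀ w)
    rw [Finset.sum_map]
    exact Finset.sum_congr rfl fun x _ => (derived_mult A switch x w).symm
  have hiff := mem_iff_mem_of_perfect A M hM
  refine ⟨Finset.univ.filter fun e => (e, none, false) ∈ M, fun v => ?_⟩
  rw [← hM (v, none, false), Finset.sum_add_distrib]
  -- The matched edges at the vertex `v` of the first copy of `A`, by the direction of the lift.
  have hsrc : ∑ x ∈ M, (if A.liftSrc x = (v, none, false) then 1 else 0) =
      ∑ e with (e, none, false) ∈ M, if A.src e = v then 1 else 0 := by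
    rw [← Finset.sum_filter, ← Finset.sum_filter, ← Finset.card_eq_sum_ones,
      ← Finset.card_eq_sum_ones]
    symm
    refine Finset.card_bij (fun e _ => (e, none, false)) ?_ ?_ ?_
    · intro e he
      simpa [liftSrc] using he
    · intro e _ e' _ h
      simpa using h
    · rintro ⟨e, k, i⟩ hx
      simp only [Finset.mem_filter, liftSrc, Prod.mk.injEq] at hx
      obtain ⟨hx, hv, rfl, rfl⟩ := hx
      exact ⟨e, by simp [hx, hv], rfl⟩
  have htgt : ∑ x ∈ M, (if A.liftTgt switch x = (v, none, false) then 1 else 0) =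
      ∑ e with (e, none, false) ∈ M, if ¬ A.IsSemi e ∧ A.tgt e = v then 1 else 0 := by
    rw [← Finset.sum_filter, ← Finset.sum_filter, ← Finset.card_eq_sum_ones,
      ← Finset.card_eq_sum_ones]
    symm
    refine Finset.card_bij (fun e _ => (e, some (e, false, 0), false)) ?_ ?_ ?_
    · intro e he
      simp only [Finset.mem_filter, Finset.mem_univ, true_and] at he
      simp [liftTgt, switch_zero, (hiff e).1 he.1, he.2.1, he.2.2]
    · intro e _ e' _ h
      simp only [Prod.mk.injEq] at h
      exact h.1
    · rintro ⟨e, k, i⟩ hx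
      simp only [Finset.mem_filter, liftTgt, Prod.mk.injEq, switch_eq_none_iff,
        Bool.or_eq_false_iff, decide_eq_false_iff_not] at hx
      obtain ⟨hx, hv, rfl, rfl, hs⟩ := hx
      exact ⟨e, by simp [(hiff e).2 hx, hv, hs], rfl⟩
  rw [hsrc, htgt, ← Finset.sum_add_distrib]
  refine Finset.sum_congr rfl fun e _ => ?_
  by_cases hs : A.IsSemi e
  · rw [mult_of_isSemi A (ends_eq_src_tgt A e) hs]
    simp [hs]
  · rw [mult_of_not_isSemi A (ends_eq_src_tgt A e) hs]
    simp [hs]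

theorem semiCovers_flower_of_stronger [Fintype V] [Fintype E] {A : SemiGraph V E}
    (h : A.Stronger (flower 1 1)) : A.SemiCovers (flower 1 1) := by
  classical
  have hs := isSimple_switched A
  have hcov := derived_covers A switch hs
  obtain ⟨gV, gE, hg⟩ := h.covers hs hcov
  obtain ⟨⟨w⟩, hcubic, hM⟩ := (semiCovers_flower_iff _).1 ⟨gV, gE, hg.toIsSemiCovering⟩
  obtain ⟨fV, fE, hf⟩ := hcov
  refine (semiCovers_flower_iff A).2 ⟨⟨w.1⟩, fun v => ?_,
    exists_isSemiPerfectMatching_of_switched A hM⟩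
  obtain ⟨u, rfl⟩ := hf.surjective_vert v
  rw [hf.degree_eq, hcubic u]

end Switched

end SemiGraph

theorem mainTheorem2 {V E : Type*} [Fintype V] [Fintype E] (A : SemiGraph V E) :
    (A.Stronger (SemiGraph.flower 1 1) ↔ A.SemiCovers (SemiGraph.flower 1 1)) ∧
    (A.SemiCovers (SemiGraph.flower 1 1) ↔
      Nonempty V ∧ A.IsCubic ∧ ∃ M : Finset E, A.IsSemiPerfectMatching M) :=
  ⟨⟨SemiGraph.semiCovers_flower_of_stronger, SemiGraph.stronger_of_semiCovers⟩,
    SemiGraph.semiCovers_flower_iff A⟩
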